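/- Let $n$ be an integer with $n\equiv 12 \pmod{27}$, put $\Delta_n=n^2+3n+9$ (which is then divisible by $27$), and suppose that $\Delta_n/27$ is squarefree. Let $\rho_n\in\mathbb{C}$ be any root of Shanks' cubic polynomial $f_n(X)=X^3-nX^2-(n+3)X-1$, and let $L_n=\mathbb{Q}(\rho_n)$ be the simplest cubic field. Then $L_n/\mathbb{Q}$ is a finite Galois extension whose Galois group is generated by an automorphism $\sigma$ with $\sigma(\rho_n)=-1/(1+\rho_n)$, and, writing $\rho_n'=\sigma(\rho_n)$ and $\rho_n''=\sigma^2(\rho_n)$, the set \[ \left\{\frac{\rho_n-\rho_n'+3}{9},\ \frac{\rho_n'-\rho_n''+3}{9},\ \frac{\rho_n''-\rho_n+3}{9}\right\} \] is a normal integral basis of $L_n$; that is, it is the set of conjugates $\{\tau(\alpha)\mid \tau\in\mathrm{Gal}(L_n/\mathbb{Q})\}$ of an element $\alpha\in L_n$, and these conjugates form a $\mathbb{Z}$-basis of the ring of integers of $L_n$. -/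

import Mathlib

open Polynomial IntermediateField

/-- Shanks' cubic polynomial `f_n(X) = X³ - nX² - (n+3)X - 1`. -/
noncomputable def shanksPoly (n : ℤ) : ℤ[X] :=
  X ^ 3 - C n * X ^ 2 - C (n + 3) * X - 1

/-- `Δ_n = n² + 3n + 9`. -/
def shanksDelta (n : ℤ) : ℤ := n ^ 2 + 3 * n + 9

/-- `S` is a normal integral basis of `K`: the extension `K/ℚ` is finite Galois, and `S` is the set
of conjugates `σ(α)`, `σ ∈ Gal(K/ℚ)`, of an algebraic integer `α ∈ K` such that these conjugates
form a `ℤ`-basis of the ring of integers of `K`. -/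
def IsNormalIntegralBasis (K : Type*) [Field K] [Algebra ℚ K] (S : Set K) : Prop :=
  FiniteDimensional ℚ K ∧ IsGalois ℚ K ∧
    ∃ (α : K) (b : Module.Basis (K ≃ₐ[ℚ] K) ℤ (NumberField.RingOfIntegers K)),
      (∀ σ : K ≃ₐ[ℚ] K, (b σ : K) = σ α) ∧ S = Set.range (fun σ : K ≃ₐ[ℚ] K => σ α)

/-!
Write `ρ, ρ', ρ''` for the roots of `f_n`, `α = (ρ - ρ' + 3) / 9` with conjugates `α, β, γ`,
`M = ℤα + ℤβ + ℤγ`, `m = Δ_n / 27` and `θ = 3ρ - n`. The congruence on `n` gives `m ≡ 7 (mod 27)`.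

The polynomial `f_n` has no integral root, so `ℚ(ρ)` is cubic, and since `-1 / (1 + ρ)` is another
root it is cyclic (`exists_shanks_automorphism`). The element `α` is integral, being a root of
`X³ - X² + ((1 - m) / 3) X - (1 - 4m) / 27` (`isIntegral_shanks_generator`).

It remains to see that every algebraic integer `x` of the field lies in `M`; two facts together
force this.

* The trace form on `α, β, γ` is circulant, with determinant `m²`, and inverting it only costs a
  factor `m`: the element `m x` is an integral combination of `α, β, γ`
  (`dual_basis_identity`, `mul_mem_span_conjugates`).
* The minimal polynomial `X³ - 3Δ_n X - (2n + 3)Δ_n` of `θ` is Eisenstein at every prime dividing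
  the squarefree number `m`, so the index of `ℤ[θ]` is prime to `m` (`mem_adjoin_of_zsmul_mem`).
  As `81 M ⊆ ℤ[θ] ⊆ M`, the element `m · 81 x` of `81 M` lies in `ℤ[θ]`; hence so does `81 x`,
  which therefore belongs to `M`.

Since `m` is prime to `3`, the memberships of `m x` and `81 x` give `x ∈ M`. Thus the three
conjugates span the ring of integers, which has rank three, and so they form a basis.
-/

/-! ### Shanks' cubic polynomial -/

theorem shanksPoly_monic (n : ℤ) : (shanksPoly n).Monic := by
  unfold shanksPoly; monicity!

theorem shanksPoly_natDegree (n : ℤ) : (shanksPoly n).natDegree = 3 := by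
  unfold shanksPoly; compute_degree!

theorem aeval_shanksPoly {K : Type*} [CommRing K] (n : ℤ) (x : K) :
    aeval x (shanksPoly n) = x ^ 3 - n * x ^ 2 - (n + 3) * x - 1 := by
  simp only [shanksPoly, map_sub, map_mul, map_pow, map_one, aeval_X, aeval_C, algebraMap_int_eq,
    Int.coe_castRingHom]
  push_cast
  ring

theorem shanksPoly_irreducible (n : ℤ) : Irreducible (shanksPoly n) := by
  rw [(shanksPoly_monic n).irreducible_iff_roots_eq_zero_of_degree_le_three
    (by rw [shanksPoly_natDegree]; norm_num) (by rw [shanksPoly_natDegree])]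
  refine Multiset.eq_zero_of_forall_notMem fun r hr => ?_
  have h : r ^ 3 - n * r ^ 2 - (n + 3) * r - 1 = 0 := by
    have h := (mem_roots'.1 hr).2
    rwa [IsRoot.def, ← coe_aeval_eq_eval, aeval_shanksPoly] at h
  have hu : IsUnit r := IsUnit.of_mul_eq_one (r ^ 2 - n * r - (n + 3)) (by linarith)
  rcases Int.isUnit_iff.1 hu with rfl | rfl
  · omega
  · ring_nf at h
    omega

theorem minpoly_int_eq {K : Type*} [Field K] [Algebra ℚ K] {g : ℤ[X]} (hg : Irreducible g)
    (hm : g.Monic) {x : K} (hx : aeval x g = 0) :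
    minpoly ℤ x = g ∧ minpoly ℚ x = g.map (algebraMap ℤ ℚ) := by
  have hint : IsIntegral ℤ x := ⟨g, hm, hx⟩
  have h : minpoly ℚ x = g.map (algebraMap ℤ ℚ) := by
    refine (minpoly.eq_of_irreducible_of_monic ?_ (by rwa [aeval_map_algebraMap]) (hm.map _)).symm
    exact hm.irreducible_iff_irreducible_map_fraction_map.1 hg
  refine ⟨map_injective _ (algebraMap ℤ ℚ).injective_int ?_, h⟩
  rw [← h, minpoly.isIntegrallyClosed_eq_field_fractions' ℚ hint]

/-- The relations among the roots `a`, `b = -1 / (1 + a)`, `c = -1 / (1 + b)` of `f_n`. -/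
theorem shanks_conjugates {K : Type*} [Field K] {n : ℤ} {a b c : K}
    (ha : aeval a (shanksPoly n) = 0) (hb : b = -1 / (1 + a)) (hc : c = -1 / (1 + b)) :
    b = a ^ 2 - (n + 1) * a - 2 ∧ c = n - a - b ∧ a = -1 / (1 + c) := by
  rw [aeval_shanksPoly] at ha
  have h0 : a ≠ 0 := by rintro rfl; norm_num at ha
  have h1 : 1 + a ≠ 0 := by
    intro h
    have : a = -1 := by linear_combination h
    rw [this] at ha
    ring_nf at ha
    norm_num at ha
  have hb' : b = a ^ 2 - (n + 1) * a - 2 := by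
    rw [hb, div_eq_iff h1]; linear_combination -ha
  have hc1 : c = -(1 + a) / a := by
    rw [hc, hb]
    have : 1 + -1 / (1 + a) = a / (1 + a) := by field_simp; ring
    rw [this]; field_simp
  refine ⟨hb', ?_, ?_⟩
  · rw [hc1, div_eq_iff h0, hb']; linear_combination ha
  · rw [hc1]
    have : 1 + -(1 + a) / a = -1 / a := by field_simp; ring
    rw [this]; field_simp

/-! ### The depressed cubic and its Eisenstein primes -/

/-- The depressed cubic `27 f_n((X + n) / 3)`, whose roots are `3ρ - n` for the roots `ρ` of
`f_n`. -/
noncomputable def depressedPoly (n : ℤ) : ℤ[X] :=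
  X ^ 3 - C (3 * shanksDelta n) * X - C ((2 * n + 3) * shanksDelta n)

theorem depressedPoly_monic (n : ℤ) : (depressedPoly n).Monic := by
  unfold depressedPoly; monicity!

theorem depressedPoly_natDegree (n : ℤ) : (depressedPoly n).natDegree = 3 := by
  unfold depressedPoly; compute_degree!

theorem aeval_depressedPoly {K : Type*} [CommRing K] (n : ℤ) (x : K) :
    aeval (3 * x - n : K) (depressedPoly n) = 27 * aeval x (shanksPoly n) := by
  rw [aeval_shanksPoly]
  simp only [depressedPoly, shanksDelta, map_sub, map_mul, map_pow, aeval_X, aeval_C,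
    algebraMap_int_eq, Int.coe_castRingHom]
  push_cast
  ring

theorem exists_shanksDelta_eq {n : ℤ} (hn : n ≡ 12 [ZMOD 27]) :
    ∃ k : ℤ, n = 12 + 27 * k ∧ shanksDelta n = 27 * (7 + 27 * k + 27 * k ^ 2) ∧
      shanksDelta n / 27 = 7 + 27 * k + 27 * k ^ 2 := by
  obtain ⟨k, hk⟩ := (Int.modEq_iff_dvd.1 hn.symm)
  have h : shanksDelta n = 27 * (7 + 27 * k + 27 * k ^ 2) := by
    rw [shanksDelta, show n = 12 + 27 * k by linarith]; ring
  exact ⟨k, by linarith, h, by rw [h]; simp⟩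

/-- At a prime `p ∣ Δ_n / 27` the polynomial is Eisenstein: `p ≠ 3` because `Δ_n / 27 ≡ 7 (mod 27)`,
and then `p ∤ 2n + 3` because `4 Δ_n = (2n + 3)² + 27`. -/
theorem depressedPoly_isEisensteinAt {n : ℤ} (hn : n ≡ 12 [ZMOD 27])
    (hsq : Squarefree (shanksDelta n / 27)) {p : ℤ} (hp : Prime p)
    (hpm : p ∣ shanksDelta n / 27) :
    (depressedPoly n).IsEisensteinAt (Ideal.span {p}) := by
  obtain ⟨k, hk, hD, hm⟩ := exists_shanksDelta_eq hn
  rw [hm] at hsq hpm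
  set m : ℤ := 7 + 27 * k + 27 * k ^ 2 with hmdef
  have hp27 : IsCoprime p 27 :=
    IsCoprime.of_isCoprime_of_dvd_left ⟨4, -(1 + 4 * k + 4 * k ^ 2), by rw [hmdef]; ring⟩ hpm
  have hpD : p ∣ shanksDelta n := hD ▸ hpm.mul_left _
  have hpn : ¬ p ∣ 2 * n + 3 := fun h => hp.not_isUnit <| hp27.isUnit_of_dvd' dvd_rfl <| by
    have : (27 : ℤ) = 4 * shanksDelta n - (2 * n + 3) * (2 * n + 3) := by
      rw [shanksDelta]; ring
    rw [this]
    exact dvd_sub (hpD.mul_left _) (h.mul_left _)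
  refine (depressedPoly_monic n).isEisensteinAt_of_mem_of_notMem ?_ ?_ ?_
  · rw [Ne, Ideal.span_singleton_eq_top]; exact hp.not_isUnit
  · intro i hi
    rw [depressedPoly_natDegree] at hi
    rw [Ideal.mem_span_singleton]
    simp only [depressedPoly, coeff_sub, coeff_X_pow, coeff_C_mul, coeff_X, coeff_C]
    interval_cases i <;> simp [hpD.mul_left]
  · rw [Ideal.span_singleton_pow, Ideal.mem_span_singleton]
    simp only [depressedPoly, coeff_sub, coeff_X_pow, coeff_C_mul, coeff_X_zero, coeff_C_zero]
    intro h
    have h1 : p ^ 2 ∣ (2 * n + 3) * m * 27 := by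
      rw [← dvd_neg]; convert h using 1; rw [hD]; norm_num; ring
    have h2 := (hp27.pow_left (m := 2)).dvd_of_dvd_mul_right h1
    have h3 := (((Prime.coprime_iff_not_dvd hp).2 hpn).pow_left (m := 2)).dvd_of_dvd_mul_left h2
    exact hp.not_isUnit (hsq p (by rwa [← sq]))

theorem depressedPoly_irreducible {n : ℤ} (hn : n ≡ 12 [ZMOD 27])
    (hsq : Squarefree (shanksDelta n / 27)) : Irreducible (depressedPoly n) := by
  obtain ⟨k, hk, hD, hm⟩ := exists_shanksDelta_eq hn
  have hnu : ¬ IsUnit (shanksDelta n / 27) := by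
    rw [hm, Int.isUnit_iff]
    rintro (h | h) <;> omega
  obtain ⟨p, hp, hpm⟩ := WfDvdMonoid.exists_irreducible_factor hnu hsq.ne_zero
  exact (depressedPoly_isEisensteinAt hn hsq hp.prime hpm).irreducible
    ((Ideal.span_singleton_prime hp.ne_zero).2 hp.prime)
    (depressedPoly_monic n).isPrimitive (by rw [depressedPoly_natDegree]; norm_num)

/-! ### The cyclic cubic field generated by a root -/

/-- A root of `f_n` generates a cyclic cubic field, with generator of the Galois group
`ρ ↦ -1 / (1 + ρ)`. -/
theorem exists_shanks_automorphism {K : Type*} [Field K] [Algebra ℚ K] {n : ℤ} {a : K}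
    (ha : aeval a (shanksPoly n) = 0) (hgen : Algebra.adjoin ℚ {a} = ⊤) :
    ∃ σ : K ≃ₐ[ℚ] K, σ a = -1 / (1 + a) ∧ Subgroup.zpowers σ = ⊤ ∧ orderOf σ = 3 ∧
      Module.finrank ℚ K = 3 ∧ FiniteDimensional ℚ K ∧ IsGalois ℚ K := by
  have := algebraRat.charZero K
  have hint : IsIntegral ℚ a := IsIntegral.tower_top (R := ℤ) ⟨_, shanksPoly_monic n, ha⟩
  have hmin := (minpoly_int_eq (shanksPoly_irreducible n) (shanksPoly_monic n) ha).2
  let B := PowerBasis.ofAdjoinEqTop hint hgen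
  have hBgen : B.gen = a := rfl
  have hfd : FiniteDimensional ℚ K := B.finite
  have hrank : Module.finrank ℚ K = 3 := by
    rw [B.finrank, ← B.natDegree_minpoly, hBgen, hmin, (shanksPoly_monic n).natDegree_map,
      shanksPoly_natDegree]
  obtain ⟨h1, h2, h3⟩ := shanks_conjugates ha rfl rfl
  have hbroot : aeval (-1 / (1 + a)) (shanksPoly n) = 0 := by
    have h0 : 1 + a ≠ 0 := by
      intro h0
      rw [aeval_shanksPoly, eq_neg_of_add_eq_zero_right h0] at ha
      ring_nf at ha
      norm_num at ha
    rw [aeval_shanksPoly] at ha ⊢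
    field_simp
    linear_combination -ha
  let φ : K →ₐ[ℚ] K := B.lift (-1 / (1 + a)) (by rw [hBgen, hmin, aeval_map_algebraMap, hbroot])
  have hφ : φ a = -1 / (1 + a) := B.lift_gen _ _
  let σ : K ≃ₐ[ℚ] K := AlgEquiv.ofBijective φ φ.bijective
  have hσa : σ a = -1 / (1 + a) := hφ
  have hσb : σ (-1 / (1 + a)) = -1 / (1 + -1 / (1 + a)) := by
    rw [map_div₀, map_neg, map_one, map_add, map_one, hσa]
  have hσ3 : σ ^ 3 = 1 := by
    refine AlgEquiv.coe_toAlgHom_injective (B.algHom_ext ?_)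
    rw [hBgen]
    change σ (σ (σ a)) = a
    rw [hσa, hσb, map_div₀, map_neg, map_one, map_add, map_one, hσb, ← h3]
  have hσ1 : σ ≠ 1 := by
    intro h
    have h4 : a = a ^ 2 - (n + 1) * a - 2 := by rw [← h1, ← hσa, h]; rfl
    -- `a` would be a root of a quadratic polynomial.
    have hq : (X ^ 2 - C (n + 2 : ℚ) * X - C 2 : ℚ[X]).natDegree = 2 := by compute_degree!
    have hle := natDegree_le_natDegree (minpoly.min ℚ a
      (p := X ^ 2 - C (n + 2 : ℚ) * X - C 2) (by monicity!) (by
        simp only [map_sub, map_mul, map_pow, aeval_X, map_add, map_intCast, map_ofNat]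
        linear_combination -h4))
    rw [hq, hmin, (shanksPoly_monic n).natDegree_map, shanksPoly_natDegree] at hle
    omega
  have hord : orderOf σ = 3 := orderOf_eq_prime hσ3 hσ1
  have hcard : Nat.card (K ≃ₐ[ℚ] K) = 3 := by
    refine le_antisymm ?_ ?_
    · rw [Nat.card_eq_fintype_card, ← hrank]; exact AlgEquiv.card_le
    · rw [← hord]; exact orderOf_le_card
  refine ⟨σ, hσa, ?_, hord, hrank, hfd,
    IsGalois.of_card_aut_eq_finrank _ _ (hcard.trans hrank.symm)⟩
  exact Subgroup.eq_top_of_card_eq _ (by rw [Nat.card_zpowers, hord, hcard])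

theorem range_eq_of_zpowers_eq_top {K : Type*} [Field K] [Algebra ℚ K] {σ : K ≃ₐ[ℚ] K}
    (hσ : Subgroup.zpowers σ = ⊤) (hord : orderOf σ = 3) (α : K) :
    Set.range (fun τ : K ≃ₐ[ℚ] K => τ α) = {α, σ α, σ (σ α)} := by
  ext x
  simp only [Set.mem_range, Set.mem_insert_iff, Set.mem_singleton_iff]
  constructor
  · rintro ⟨τ, rfl⟩
    have hτ : τ ∈ Subgroup.zpowers σ := hσ ▸ Subgroup.mem_top τ
    classical
    have hfin : IsOfFinOrder σ := orderOf_pos_iff.1 (by omega)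
    obtain ⟨i, hi, rfl⟩ := Finset.mem_image.1 (hfin.mem_zpowers_iff_mem_range_orderOf.1 hτ)
    rw [hord, Finset.mem_range] at hi
    interval_cases i
    exacts [Or.inl rfl, Or.inr (Or.inl rfl), Or.inr (Or.inr rfl)]
  · rintro (rfl | rfl | rfl)
    exacts [⟨1, rfl⟩, ⟨σ, rfl⟩, ⟨σ * σ, rfl⟩]

/-! ### Integrality of the normal generator -/

/-- With `Δ_n = 27 m`, the element `α = (ρ - ρ' + 3) / 9` is a root of
`X³ - X² + ((1 - m) / 3) X - (1 - 4m) / 27`, whose coefficients are integers because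
`m ≡ 7 (mod 27)`. -/
theorem isIntegral_shanks_generator {K : Type*} [Field K] [CharZero K] {n : ℤ}
    (hn : n ≡ 12 [ZMOD 27]) {a b : K} (ha : aeval a (shanksPoly n) = 0)
    (hb : b = a ^ 2 - (n + 1) * a - 2) : IsIntegral ℤ ((a - b + 3) / 9) := by
  obtain ⟨k, hk, hD, -⟩ := exists_shanksDelta_eq hn
  rw [aeval_shanksPoly] at ha
  refine ⟨X ^ 3 - X ^ 2 - C (2 + 9 * k + 9 * k ^ 2) * X + C (1 + 4 * k + 4 * k ^ 2), by monicity!,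
    ?_⟩
  rw [← aeval_def]
  simp only [map_sub, map_add, map_mul, map_pow, aeval_X, aeval_C,
    algebraMap_int_eq, Int.coe_castRingHom]
  subst hb hk
  push_cast at ha ⊢
  -- Substituting `α` into its cubic gives `f_n` times a cubic polynomial in `a`.
  linear_combination (-a ^ 3 + (30 + 54 * (k : K)) * a ^ 2 -
    (237 + 837 * (k : K) + 729 * (k : K) ^ 2) * a +
    (181 + 729 * (k : K) + 729 * (k : K) ^ 2)) / 729 * ha

/-! ### Inverting the trace form -/

/-- Dual basis formula: if the trace form of the conjugates `α, β, γ` has off-diagonal entry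
`B = αβ + βγ + γα` and `α + β + γ = 1`, then `(1 - 3B) x` is a combination of `α, β, γ` whose
coefficients are traces. -/
theorem dual_basis_identity {K : Type*} [CommRing K] {α β γ : K} (h : α + β + γ = 1) (x y z : K) :
    (1 - 3 * (α * β + β * γ + γ * α)) * x =
      (x * α + y * β + z * γ - (α * β + β * γ + γ * α) * (x + y + z)) * α +
      (x * β + y * γ + z * α - (α * β + β * γ + γ * α) * (x + y + z)) * β +
      (x * γ + y * α + z * β - (α * β + β * γ + γ * α) * (x + y + z)) * γ := by
  obtain rfl : γ = 1 - α - β := by linear_combination h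
  ring

theorem exists_int_eq_trace {K : Type*} [Field K] [Algebra ℚ K]
    [FiniteDimensional ℚ K] [IsGalois ℚ K] {σ : K ≃ₐ[ℚ] K}
    (hσ : Subgroup.zpowers σ = ⊤) (hσ3 : ∀ x, σ (σ (σ x)) = x) {x : K} (hx : IsIntegral ℤ x) :
    ∃ t : ℤ, x + σ x + σ (σ x) = t := by
  have hfix : ∀ τ : K ≃ₐ[ℚ] K, τ (x + σ x + σ (σ x)) = x + σ x + σ (σ x) := by
    have hle : Subgroup.zpowers σ ≤ MulAction.stabilizer (K ≃ₐ[ℚ] K) (x + σ x + σ (σ x)) := by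
      rw [Subgroup.zpowers_le, MulAction.mem_stabilizer_iff, AlgEquiv.smul_def]
      simp only [map_add, hσ3]
      ring
    intro τ
    exact hle (hσ ▸ Subgroup.mem_top τ)
  obtain ⟨q, hq⟩ := (IsGalois.mem_range_algebraMap_iff_fixed (F := ℚ) _).2 hfix
  have hint : IsIntegral ℤ (x + σ x + σ (σ x)) :=
    (hx.add (hx.map (σ.toAlgHom.restrictScalars ℤ))).add
      ((hx.map (σ.toAlgHom.restrictScalars ℤ)).map (σ.toAlgHom.restrictScalars ℤ))
  rw [← hq, isIntegral_algebraMap_iff (algebraMap ℚ K).injective] at hint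
  obtain ⟨t, ht⟩ := IsIntegrallyClosed.isIntegral_iff.1 hint
  exact ⟨t, by rw [← hq, ← ht]; simp⟩

/-- The coefficients of `m x`, where `m = Δ_n / 27`, in the dual basis formula are traces of
algebraic integers: `αβ + βγ + γα = (1 - m) / 3`, so the factor `1 - 3 (αβ + βγ + γα)` is `m`. -/
theorem mul_mem_span_conjugates {K : Type*} [Field K] [Algebra ℚ K]
    [CharZero K] [FiniteDimensional ℚ K] [IsGalois ℚ K] {n : ℤ}
    (hn : n ≡ 12 [ZMOD 27]) {σ : K ≃ₐ[ℚ] K} (hσ : Subgroup.zpowers σ = ⊤)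
    (hσ3 : ∀ x, σ (σ (σ x)) = x) {a : K} (ha : aeval a (shanksPoly n) = 0)
    (hb : σ a = a ^ 2 - (n + 1) * a - 2) (hc : σ (σ a) = n - a - σ a)
    {x : K} (hx : IsIntegral ℤ x) :
    (shanksDelta n / 27) • x ∈ Submodule.span ℤ
      {(a - σ a + 3) / 9, (σ a - σ (σ a) + 3) / 9, (σ (σ a) - a + 3) / 9} := by
  obtain ⟨k, hk, hD, hm⟩ := exists_shanksDelta_eq hn
  have hα := isIntegral_shanks_generator hn ha hb
  have hβ : σ ((a - σ a + 3) / 9) = (σ a - σ (σ a) + 3) / 9 := by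
    rw [map_div₀, map_add, map_sub, map_ofNat, map_ofNat]
  have hγ : σ ((σ a - σ (σ a) + 3) / 9) = (σ (σ a) - a + 3) / 9 := by
    rw [map_div₀, map_add, map_sub, map_ofNat, map_ofNat, hσ3]
  have hα' : σ ((σ (σ a) - a + 3) / 9) = (a - σ a + 3) / 9 := by
    rw [map_div₀, map_add, map_sub, map_ofNat, map_ofNat, hσ3]
  have hβi := hα.map (σ.toAlgHom.restrictScalars ℤ)
  have hγi := hβi.map (σ.toAlgHom.restrictScalars ℤ)
  change IsIntegral ℤ (σ _) at hβi
  change IsIntegral ℤ (σ (σ _)) at hγi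
  rw [hβ] at hβi
  rw [hβ, hγ] at hγi
  have hB : (a - σ a + 3) / 9 * ((σ a - σ (σ a) + 3) / 9) +
      (σ a - σ (σ a) + 3) / 9 * ((σ (σ a) - a + 3) / 9) +
      (σ (σ a) - a + 3) / 9 * ((a - σ a + 3) / 9) = ((-(2 + 9 * k + 9 * k ^ 2) : ℤ) : K) := by
    rw [hc, hb]
    rw [aeval_shanksPoly] at ha
    subst hk
    push_cast at ha ⊢
    -- As a polynomial in `a`, the difference of the two sides is this multiple of `f_n`.
    linear_combination ((13 + 27 * k - a) / 27 : K) * ha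
  have hsum : (a - σ a + 3) / 9 + (σ a - σ (σ a) + 3) / 9 + (σ (σ a) - a + 3) / 9 = 1 := by ring
  have key := dual_basis_identity hsum x (σ x) (σ (σ x))
  rw [hB] at key
  obtain ⟨t, ht⟩ := exists_int_eq_trace hσ hσ3 hx
  obtain ⟨p, hp⟩ := exists_int_eq_trace hσ hσ3 (hx.mul hα)
  obtain ⟨q, hq⟩ := exists_int_eq_trace hσ hσ3 (hx.mul hβi)
  obtain ⟨r, hr⟩ := exists_int_eq_trace hσ hσ3 (hx.mul hγi)
  simp only [map_mul, hβ, hγ, hα'] at hp hq hr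
  rw [ht, hp, hq, hr] at key
  rw [Submodule.mem_span_triple]
  refine ⟨p + (2 + 9 * k + 9 * k ^ 2) * t, q + (2 + 9 * k + 9 * k ^ 2) * t,
    r + (2 + 9 * k + 9 * k ^ 2) * t, ?_⟩
  rw [hm]
  simp only [zsmul_eq_mul]
  push_cast at key ⊢
  linear_combination -key

/-! ### Comparison with the order generated by `3ρ - n` -/

theorem adjoin_three_mul_sub_eq_top {K : Type*} [Field K] [Algebra ℚ K]
    {a : K} (ha : Algebra.adjoin ℚ {a} = ⊤) (n : ℤ) :
    Algebra.adjoin ℚ {3 * a - (n : K)} = ⊤ := by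
  have := algebraRat.charZero K
  refine top_le_iff.1 (ha.symm.trans_le ?_)
  refine Algebra.adjoin_le (Set.singleton_subset_iff.2 ?_)
  have h : a = (1 / 3 : ℚ) • ((3 * a - (n : K)) + algebraMap ℚ K n) := by
    rw [Algebra.smul_def]; simp
  have hmem := Subalgebra.smul_mem _ (add_mem
    (Algebra.self_mem_adjoin_singleton ℚ (3 * a - (n : K)))
    (Subalgebra.algebraMap_mem (Algebra.adjoin ℚ {3 * a - (n : K)}) (n : ℚ))) (1 / 3 : ℚ)
  rwa [← h] at hmem

/-- Eisenstein polynomials at all primes dividing `Δ_n / 27` make the index of `ℤ[3ρ - n]` in the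
ring of integers prime to `Δ_n / 27`. -/
theorem mem_adjoin_of_zsmul_mem {K : Type*} [Field K] [Algebra ℚ K]
    {n : ℤ} (hn : n ≡ 12 [ZMOD 27])
    (hsq : Squarefree (shanksDelta n / 27)) {a : K} (ha : aeval a (shanksPoly n) = 0)
    (hgen : Algebra.adjoin ℚ {a} = ⊤) (d : ℤ) (hd : d ∣ shanksDelta n / 27) :
    ∀ z : K, IsIntegral ℤ z → d • z ∈ Algebra.adjoin ℤ {3 * a - (n : K)} →
      z ∈ Algebra.adjoin ℤ {3 * a - (n : K)} := by
  have hroot : aeval (3 * a - (n : K)) (depressedPoly n) = 0 := by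
    rw [aeval_depressedPoly, ha, mul_zero]
  have hint : IsIntegral ℤ (3 * a - (n : K)) := ⟨_, depressedPoly_monic n, hroot⟩
  have hmin := (minpoly_int_eq (depressedPoly_irreducible hn hsq) (depressedPoly_monic n) hroot).1
  let B := PowerBasis.ofAdjoinEqTop (hint.tower_top (A := ℚ)) (adjoin_three_mul_sub_eq_top hgen n)
  have hB : B.gen = 3 * a - (n : K) := rfl
  induction d using UniqueFactorizationMonoid.induction_on_prime with
  | h₁ => exact absurd (zero_dvd_iff.1 hd) hsq.ne_zero
  | h₂ u hu =>
    intro z _ hz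
    obtain ⟨v, hv⟩ := hu.exists_left_inv
    have := Subalgebra.smul_mem _ hz v
    rwa [smul_smul, hv, one_smul] at this
  | h₃ d p _ hp ih =>
    intro z hz hz'
    refine ih (dvd_of_mul_left_dvd hd) z hz ?_
    rw [mul_smul] at hz'
    have key := mem_adjoin_of_smul_prime_smul_of_minpoly_isEisensteinAt (B := B) hp
      (hB ▸ hint) (hz.smul d) (hB ▸ hz') (by
        rw [hB, hmin]
        exact depressedPoly_isEisensteinAt hn hsq hp (dvd_of_mul_right_dvd hd))
    exact hB ▸ key

/-- The inclusion `ℤ[θ] ⊆ ℤα + ℤβ + ℤγ` for `θ = 3ρ - n`. -/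
theorem adjoin_le_span_conjugates {K : Type*} [Field K] [CharZero K] {n : ℤ} {a b c : K}
    (ha : aeval a (shanksPoly n) = 0) (hb : b = a ^ 2 - (n + 1) * a - 2) (hc : c = n - a - b)
    {z : K} (hz : z ∈ Algebra.adjoin ℤ {3 * a - (n : K)}) :
    z ∈ Submodule.span ℤ {(a - b + 3) / 9, (b - c + 3) / 9, (c - a + 3) / 9} := by
  set θ : K := 3 * a - n with hθ
  have hθ3 : θ ^ 3 = (3 * shanksDelta n : ℤ) * θ + ((2 * n + 3) * shanksDelta n : ℤ) := by
    have h := aeval_depressedPoly n a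
    rw [ha, mul_zero, ← hθ] at h
    simp only [depressedPoly, map_sub, map_mul, map_pow, aeval_X, aeval_C, algebraMap_int_eq,
      Int.coe_castRingHom] at h
    push_cast at h ⊢
    linear_combination h
  -- `1, θ, θ²` span `ℤ[θ]` because `θ` satisfies a monic cubic.
  have hquad : ∃ u v w : ℤ, z = u + v * θ + w * θ ^ 2 := by
    induction hz using Algebra.adjoin_induction with
    | mem x hx => exact ⟨0, 1, 0, by rw [Set.mem_singleton_iff.1 hx]; simp⟩
    | algebraMap r => exact ⟨r, 0, 0, by simp⟩
    | add x y _ _ hx hy =>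
      obtain ⟨u, v, w, rfl⟩ := hx
      obtain ⟨u', v', w', rfl⟩ := hy
      exact ⟨u + u', v + v', w + w', by push_cast; ring⟩
    | mul x y _ _ hx hy =>
      obtain ⟨u, v, w, rfl⟩ := hx
      obtain ⟨u', v', w', rfl⟩ := hy
      generalize 3 * shanksDelta n = p, (2 * n + 3) * shanksDelta n = q at hθ3
      refine ⟨u * u' + q * (v * w' + w * v'),
        u * v' + v * u' + p * (v * w' + w * v') + q * (w * w'),
        u * w' + v * v' + w * u' + p * (w * w'), ?_⟩
      push_cast
      linear_combination ((v : K) * w' + w * v' + w * w' * θ) * hθ3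
  obtain ⟨u, v, w, rfl⟩ := hquad
  rw [Submodule.mem_span_triple]
  -- `1 = α + β + γ`, `θ = 9α - 9γ`, and `θ² = 9b + (n + 3)(3a) + n² + 18` where
  -- `3a = n + 9α - 9γ` and `3b = n + 9β - 9α`.
  refine ⟨u + 9 * v + w * (2 * n ^ 2 + 6 * n + 18 + 9 * n), u + w * (2 * n ^ 2 + 6 * n + 18 + 27),
    u - 9 * v + w * (2 * n ^ 2 + 6 * n + 18 - 9 * (n + 3)), ?_⟩
  simp only [zsmul_eq_mul, hθ, hc, hb]
  push_cast
  field_simp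
  ring

/-- The inclusion `81 (ℤα + ℤβ + ℤγ) ⊆ ℤ[θ]` for `θ = 3ρ - n`: the numbers `9ρ, 9ρ', 9ρ''` are
polynomials in `θ` with integer coefficients. -/
theorem smul_mem_adjoin_of_mem_span {K : Type*} [Field K] [CharZero K] {n : ℤ} {a b c : K}
    (hb : b = a ^ 2 - (n + 1) * a - 2) (hc : c = n - a - b)
    {z : K} (hz : z ∈ Submodule.span ℤ {(a - b + 3) / 9, (b - c + 3) / 9, (c - a + 3) / 9}) :
    (81 : ℤ) • z ∈ Algebra.adjoin ℤ {3 * a - (n : K)} := by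
  set A := Algebra.adjoin ℤ {3 * a - (n : K)}
  obtain ⟨u, v, w, rfl⟩ := Submodule.mem_span_triple.1 hz
  have hθ : 3 * a - (n : K) ∈ A := Algebra.self_mem_adjoin_singleton ℤ _
  have hn : ∀ t : ℤ, (t : K) ∈ A := fun t => intCast_mem A t
  have h9a : 9 * a ∈ A := by
    have := add_mem (A.mul_mem (hn 3) hθ) (hn (3 * n))
    convert this using 1; push_cast; ring
  have h9b : 9 * b ∈ A := by
    have := add_mem (A.pow_mem hθ 2) (add_mem (A.mul_mem (hn (-n - 3)) hθ)
      (hn (-(2 * n ^ 2 + 3 * n + 18))))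
    convert this using 1; rw [hb]; push_cast; ring
  have h9c : 9 * c ∈ A := by
    have := sub_mem (sub_mem (hn (9 * n)) h9a) h9b
    convert this using 1; rw [hc]; push_cast; ring
  have h27 := hn 27
  have := add_mem (add_mem (A.smul_mem (add_mem (sub_mem h9a h9b) h27) u)
    (A.smul_mem (add_mem (sub_mem h9b h9c) h27) v)) (A.smul_mem (add_mem (sub_mem h9c h9a) h27) w)
  convert this using 1
  simp only [zsmul_eq_mul]
  push_cast
  ring

/-! ### The ring of integers -/

theorem mem_span_conjugates_of_isIntegral {K : Type*} [Field K] [Algebra ℚ K]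
    [FiniteDimensional ℚ K] [IsGalois ℚ K] {n : ℤ} (hn : n ≡ 12 [ZMOD 27])
    (hsq : Squarefree (shanksDelta n / 27)) {σ : K ≃ₐ[ℚ] K} (hσ : Subgroup.zpowers σ = ⊤)
    (hσ3 : ∀ x, σ (σ (σ x)) = x) {a : K} (ha : aeval a (shanksPoly n) = 0)
    (hgen : Algebra.adjoin ℚ {a} = ⊤)
    (hb : σ a = a ^ 2 - (n + 1) * a - 2) (hc : σ (σ a) = n - a - σ a)
    {x : K} (hx : IsIntegral ℤ x) :
    x ∈ Submodule.span ℤ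
      {(a - σ a + 3) / 9, (σ a - σ (σ a) + 3) / 9, (σ (σ a) - a + 3) / 9} := by
  have := algebraRat.charZero K
  have h1 := mul_mem_span_conjugates hn hσ hσ3 ha hb hc hx
  have h2 := smul_mem_adjoin_of_mem_span hb hc h1
  rw [smul_comm] at h2
  have h3 := adjoin_le_span_conjugates ha hb hc
    (mem_adjoin_of_zsmul_mem hn hsq ha hgen _ dvd_rfl _ (hx.smul (81 : ℤ)) h2)
  -- `Δ_n / 27` is prime to `3`, so `x` is recovered from `81 x` and `(Δ_n / 27) x`.
  obtain ⟨k, -, -, hm⟩ := exists_shanksDelta_eq hn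
  have hcop : IsCoprime (shanksDelta n / 27) 81 := by
    have h27 : IsCoprime (shanksDelta n / 27) 27 :=
      ⟨4, -(1 + 4 * k + 4 * k ^ 2), by rw [hm]; ring⟩
    exact (h27.mul_right h27).of_isCoprime_of_dvd_right ⟨9, by norm_num⟩
  obtain ⟨u, v, huv⟩ := hcop
  have h4 := add_mem (Submodule.smul_mem _ u h1) (Submodule.smul_mem _ v h3)
  rwa [smul_smul, smul_smul, ← add_smul, huv, one_smul] at h4

theorem mainTheorem7 (n : ℤ) (hn : n ≡ 12 [ZMOD 27]) (hsq : Squarefree (shanksDelta n / 27))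
    (ρ₀ : ℂ) (hρ₀ : aeval ρ₀ (shanksPoly n) = 0)
    (ρ : ℚ⟮ρ₀⟯) (hρ : ρ = AdjoinSimple.gen ℚ ρ₀) :
    ∃ σ : ℚ⟮ρ₀⟯ ≃ₐ[ℚ] ℚ⟮ρ₀⟯,
      Subgroup.zpowers σ = ⊤ ∧ σ ρ = -1 / (1 + ρ) ∧
      IsNormalIntegralBasis ℚ⟮ρ₀⟯
        {(ρ - σ ρ + 3) / 9, (σ ρ - σ (σ ρ) + 3) / 9, (σ (σ ρ) - ρ + 3) / 9} := by
  have hρK : aeval ρ (shanksPoly n) = 0 := by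
    apply (algebraMap ℚ⟮ρ₀⟯ ℂ).injective
    rw [← aeval_algebraMap_apply, hρ, AdjoinSimple.algebraMap_gen, hρ₀, map_zero]
  have hint : IsIntegral ℚ ρ₀ := IsIntegral.tower_top (R := ℤ) ⟨_, shanksPoly_monic n, hρ₀⟩
  have hgen : Algebra.adjoin ℚ {ρ} = ⊤ := by
    rw [hρ]
    exact (adjoin.powerBasis hint).adjoin_gen_eq_top
  obtain ⟨σ, hσρ, hσ, hord, hrank, hfd, hgal⟩ := exists_shanks_automorphism hρK hgen
  refine ⟨σ, hσ, hσρ, hfd, hgal, ?_⟩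
  obtain ⟨h1, h2, -⟩ := shanks_conjugates hρK hσρ rfl
  have hσσρ : σ (σ ρ) = -1 / (1 + σ ρ) := by
    conv_lhs => rw [hσρ]
    rw [map_div₀, map_neg, map_one, map_add, map_one]
  rw [← hσσρ] at h2
  have hσ3 : ∀ x, σ (σ (σ x)) = x := fun x => by
    have h := pow_orderOf_eq_one σ
    rw [hord] at h
    exact DFunLike.congr_fun h x
  set α : ℚ⟮ρ₀⟯ := (ρ - σ ρ + 3) / 9 with hα
  have hσα : σ α = (σ ρ - σ (σ ρ) + 3) / 9 := by
    rw [hα, map_div₀, map_add, map_sub, map_ofNat, map_ofNat]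
  have hσσα : σ (σ α) = (σ (σ ρ) - ρ + 3) / 9 := by
    rw [hσα, map_div₀, map_add, map_sub, map_ofNat, map_ofNat, hσ3]
  have hset : {α, (σ ρ - σ (σ ρ) + 3) / 9, (σ (σ ρ) - ρ + 3) / 9} =
      Set.range (fun τ : ℚ⟮ρ₀⟯ ≃ₐ[ℚ] ℚ⟮ρ₀⟯ => τ α) := by
    rw [range_eq_of_zpowers_eq_top hσ hord, hσσα, hσα]
  have hαint : IsIntegral ℤ α := isIntegral_shanks_generator hn hρK h1
  have : NumberField ℚ⟮ρ₀⟯ := { to_finiteDimensional := hfd }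
  let v (τ : ℚ⟮ρ₀⟯ ≃ₐ[ℚ] ℚ⟮ρ₀⟯) : NumberField.RingOfIntegers ℚ⟮ρ₀⟯ :=
    ⟨τ α, hαint.map (τ.toAlgHom.restrictScalars ℤ)⟩
  have hspan : ⊤ ≤ Submodule.span ℤ (Set.range v) := by
    rintro ⟨x, hx⟩ -
    have h := mem_span_conjugates_of_isIntegral hn hsq hσ hσ3 hρK hgen h1 h2 hx
    rw [← hα, hset] at h
    let ι : NumberField.RingOfIntegers ℚ⟮ρ₀⟯ →ₗ[ℤ] ℚ⟮ρ₀⟯ :=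
      (Algebra.linearMap (NumberField.RingOfIntegers ℚ⟮ρ₀⟯) ℚ⟮ρ₀⟯).restrictScalars ℤ
    have hι : Function.Injective ι := NumberField.RingOfIntegers.coe_injective
    have hr : Set.range (fun τ : ℚ⟮ρ₀⟯ ≃ₐ[ℚ] ℚ⟮ρ₀⟯ => τ α) = ι '' Set.range v := by
      rw [← Set.range_comp]; rfl
    rw [hr, ← Submodule.map_span] at h
    obtain ⟨y, hy, hyx⟩ := h
    rwa [← hι (a₁ := y) (a₂ := ⟨x, hx⟩) hyx]
  have hcard : Fintype.card (ℚ⟮ρ₀⟯ ≃ₐ[ℚ] ℚ⟮ρ₀⟯) =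
      Module.finrank ℤ (NumberField.RingOfIntegers ℚ⟮ρ₀⟯) := by
    rw [NumberField.RingOfIntegers.rank, ← Nat.card_eq_fintype_card,
      IsGalois.card_aut_eq_finrank]
  refine ⟨α, basisOfTopLeSpanOfCardEqFinrank v hspan hcard, fun τ => ?_, hset⟩
  rw [coe_basisOfTopLeSpanOfCardEqFinrank]
  rfl
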